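/- Let $k$ be a commutative ring. For finite sets $X,Y$, a correspondence from $X$ to $Y$ is a subset of $Y\times X$; the composite of $Q\subseteq Z\times Y$ and $S\subseteq Y\times X$ is $QS=\{(z,x)\mid \exists y\in Y,\ (z,y)\in Q,\ (y,x)\in S\}$. Let $\mathcal C$ be the category of finite sets and correspondences, $\mathcal C(Y,X)$ the set of correspondences from $X$ to $Y$, and $k\mathcal C$ the $k$-linearization of $\mathcal C$. A correspondence functor is a $k$-linear functor $k\mathcal C\to k\text{-Mod}$; morphisms are natural transformations. *Fundamental functors.* Let $(E,R)$ be a finite poset, where $(a,b)\in R$ means $a\le_R b$. Let $I_E$ be the two-sided ideal of $k\mathcal C(E,E)$ generated by the relations which factor through a set of cardinality smaller than $|E|$, and let $\mathcal P_E$ (the algebra of permuted orders) be the quotient of $k\mathcal C(E,E)/I_E$ by the two-sided ideal generated by the classes of $S-\overline S$, where $S$ is a reflexive relation on $E$ and $\overline S$ is its transitive closure. Let $f_R=\sum_{S\supseteq R}\mu(R,S)\,S\in\mathcal P_E$, where $S$ runs over the partial orders on $E$ containing $R$ and $\mu$ is the Möbius function of the set of all partial orders on $E$, ordered by inclusion.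 The left ideal $\mathcal P_Ef_R$ is a left $k\mathcal C(E,E)$-module. For a left $k\mathcal C(E,E)$-module $W$, set $L_{E,W}=k\mathcal C(-,E)\otimes_{k\mathcal C(E,E)}W$ and $$J_{E,W}(X)=\Big\{\sum_i\phi_i\otimes w_i\in L_{E,W}(X)\ \Big|\ \forall\psi\in k\mathcal C(E,X),\ \sum_i(\psi\phi_i)\cdot w_i=0\Big\}.$$ The fundamental functor of $(E,R)$ is $\mathbb S_{E,R}=L_{E,\mathcal P_Ef_R}/J_{E,\mathcal P_Ef_R}$. *Functors of lattices.* For a finite (nonempty) lattice $T$, the correspondence functor $F_T$ maps a finite set $X$ to the free $k$-module with basis the set of all maps $X\to T$, and a correspondence $Q\subseteq Y\times X$ sends $\varphi:X\to T$ to the map $Y\to T$, $y\mapsto\bigvee_{(y,x)\in Q}\varphi(x)$. For the opposite lattice $T^{op}$, the action of $Q$ on $F_{T^{op}}$ is written $Q\star\psi$; thus $(Q\star\psi)(y)=\bigwedge_{(y,x)\in Q}\psi(x)$, with the meet taken in $T$. **Theorem.** Let $T$ be a finite lattice and let $(E,R)$ be the full subposet of its (join-)irreducible elements. For $t\in T$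 let $r(t)=\bigvee_{s<t}s$. For $A\subseteq E$ let $\eta_A^\circ:E\to T^{op}$ be the map given by $\eta_A^\circ(e)=r(e)$ if $e\in A$ and $\eta_A^\circ(e)=e$ if $e\notin A$, and let $$\gamma_T=\sum_{A\subseteq E}(-1)^{|A|}\eta_A^\circ\in F_{T^{op}}(E).$$ (a) The subfunctor $\langle\gamma_T\rangle$ of $F_{T^{op}}$ generated by $\gamma_T$ is isomorphic to $\mathbb S_{E,R}$. (b) In other words, for every finite set $X$, the module $\langle\gamma_T\rangle(X)$ is the $k$-submodule of $F_{T^{op}}(X)$ generated by the elements $S\star\gamma_T$ for $S\subseteq X\times E$, and $\mathbb S_{E,R}(X)$ is isomorphic to this submodule. -/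

import Mathlib

open CategoryTheory
open scoped TensorProduct

universe u v w

noncomputable section

/-! ### Subfunctors and quotients of functors with values in modules -/

section Subfunctors

variable {k : Type v} [CommRing k] {D : Type u} [Category.{w} D]

/-- A subfunctor of a functor with values in `k`-modules. -/
structure ModSubfunctor (F : D ⥤ ModuleCat.{w} k) where
  /-- The evaluation of the subfunctor at an object. -/
  obj (X : D) : Submodule k (F.obj X)
  map_mem {X Y : D} (f : X ⟶ Y) {x : F.obj X} (hx : x ∈ obj X) : (F.map f).hom x ∈ obj Y

namespace ModSubfunctor

variable {F : D ⥤ ModuleCat.{w} k}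

/-- A subfunctor, regarded as a functor. -/
def toFunctor (G : ModSubfunctor F) : D ⥤ ModuleCat.{w} k where
  obj X := ModuleCat.of k (G.obj X)
  map f := ModuleCat.ofHom ((F.map f).hom.restrict fun _ hx => G.map_mem f hx)
  map_id X := by ext x; simp
  map_comp f g := by ext x; simp

/-- The quotient of a functor by a subfunctor. -/
def quotient (G : ModSubfunctor F) : D ⥤ ModuleCat.{w} k where
  obj X := ModuleCat.of k (F.obj X ⧸ G.obj X)
  map {X Y} f := ModuleCat.ofHom
    ((G.obj X).mapQ (G.obj Y) (F.map f).hom fun _ hx => G.map_mem f hx)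
  map_id X := by
    ext x
    simp
  map_comp f g := by
    ext x
    simp

/-- The subfunctor of `F` generated by `x ∈ F(E)`: the intersection of all the subfunctors `G`
of `F` such that `x ∈ G(E)`. -/
def generatedBy (F : D ⥤ ModuleCat.{w} k) {E : D} (x : F.obj E) : ModSubfunctor F where
  obj X := ⨅ (G : ModSubfunctor F) (_ : x ∈ G.obj E), G.obj X
  map_mem f y hy := by
    simp only [Submodule.mem_iInf] at hy ⊢
    exact fun G hG => G.map_mem f (hy G hG)

section Linear

variable [Preadditive D] [Linear k D] [F.Additive] [F.Linear k] (G : ModSubfunctor F)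

instance : G.toFunctor.Additive where
  map_add {X Y f g} := by
    refine ModuleCat.hom_ext (LinearMap.ext fun x => Subtype.ext ?_)
    exact congrArg (fun h => h.hom x.1) (F.map_add (f := f) (g := g))

instance : G.toFunctor.Linear k where
  map_smul {X Y} f r := by
    refine ModuleCat.hom_ext (LinearMap.ext fun x => Subtype.ext ?_)
    exact congrArg (fun h => h.hom x.1) (Functor.Linear.map_smul (F := F) f r)

instance : G.quotient.Additive where
  map_add {X Y f g} := by
    refine ModuleCat.hom_ext (Submodule.linearMap_qext _ (LinearMap.ext fun x => ?_))
    exact congrArg (fun h => (G.obj Y).mkQ (h.hom x)) (F.map_add (f := f) (g := g))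

instance : G.quotient.Linear k where
  map_smul {X Y} f r := by
    refine ModuleCat.hom_ext (Submodule.linearMap_qext _ (LinearMap.ext fun x => ?_))
    exact congrArg (fun h => (G.obj Y).mkQ (h.hom x)) (Functor.Linear.map_smul (F := F) f r)

end Linear

end ModSubfunctor

end Subfunctors

/-! ### The functors `L_{E,W}` and `J_{E,W}` -/

section Induction

variable (k : Type v) [CommRing k] {D : Type u} [Category.{w} D] [Preadditive D] [Linear k D]
  (E : D) (W : Type w) [AddCommGroup W] [Module k W] [Module (End E) W] [IsScalarTower k (End E) W]

set_option linter.unusedSectionVars false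

/-- The submodule of `Hom(E, X) ⊗_k W` spanned by the elements
`(φ ∘ a) ⊗ w - φ ⊗ (a • w)`, for `a ∈ End(E)`. -/
def balancingSubmodule (X : D) : Submodule k ((E ⟶ X) ⊗[k] W) :=
  Submodule.span k {t | ∃ (φ : E ⟶ X) (a : End E) (m : W),
    t = (a.asHom ≫ φ) ⊗ₜ[k] m - φ ⊗ₜ[k] (a • m)}

/-- The tensor product `Hom(E, X) ⊗_{End(E)} W`, as a `k`-module. -/
abbrev EndTensor (X : D) : Type w :=
  ((E ⟶ X) ⊗[k] W) ⧸ balancingSubmodule k E W X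

/-- The map `Hom(E, X) ⊗_{End(E)} W → Hom(E, Y) ⊗_{End(E)} W` sending `φ ⊗ w` to
`(α ∘ φ) ⊗ w`. -/
def endTensorMap {X Y : D} (α : X ⟶ Y) : EndTensor k E W X →ₗ[k] EndTensor k E W Y :=
  Submodule.mapQ _ _ (LinearMap.rTensor W (Linear.rightComp k E α)) <| by
    refine Submodule.span_le.2 ?_
    rintro _ ⟨φ, a, m, rfl⟩
    refine Submodule.subset_span ⟨φ ≫ α, a, m, ?_⟩
    simp [Linear.rightComp]

/-- The functor `L_{E,W} = Hom(E, -) ⊗_{End(E)} W`. -/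
def inducedFunctorL : D ⥤ ModuleCat.{w} k where
  obj X := ModuleCat.of k (EndTensor k E W X)
  map α := ModuleCat.ofHom (endTensorMap k E W α)
  map_id X := by
    refine ModuleCat.hom_ext (Submodule.linearMap_qext _ (TensorProduct.ext' fun φ m => ?_))
    simp [endTensorMap, Linear.rightComp]
  map_comp α β := by
    refine ModuleCat.hom_ext (Submodule.linearMap_qext _ (TensorProduct.ext' fun φ m => ?_))
    simp [endTensorMap, Linear.rightComp]

lemma endTensorMap_add {X Y : D} (α β : X ⟶ Y) :
    endTensorMap k E W (α + β) = endTensorMap k E W α + endTensorMap k E W β := by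
  refine Submodule.linearMap_qext _ (TensorProduct.ext' fun φ m => ?_)
  simp [endTensorMap, Linear.rightComp, TensorProduct.add_tmul]

lemma endTensorMap_smul {X Y : D} (r : k) (α : X ⟶ Y) :
    endTensorMap k E W (r • α) = r • endTensorMap k E W α := by
  refine Submodule.linearMap_qext _ (TensorProduct.ext' fun φ m => ?_)
  simp [endTensorMap, Linear.rightComp, ← TensorProduct.smul_tmul']

instance : (inducedFunctorL k E W).Additive where
  map_add := ModuleCat.hom_ext (endTensorMap_add k E W _ _)

instance : (inducedFunctorL k E W).Linear k where
  map_smul f r := ModuleCat.hom_ext (endTensorMap_smul k E W r f)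

/-- For `ψ : X ⟶ E`, the map `Hom(E, X) ⊗_{End(E)} W → W` sending `φ ⊗ w` to `(ψ ∘ φ) • w`. -/
def evalAgainst {X : D} (ψ : X ⟶ E) : EndTensor k E W X →ₗ[k] W :=
  Submodule.liftQ _
    (TensorProduct.lift
      (((Algebra.lsmul k k W).toLinearMap : End E →ₗ[k] Module.End k W) ∘ₗ
        (Linear.rightComp k E ψ : (E ⟶ X) →ₗ[k] End E))) <| by
    refine Submodule.span_le.2 ?_
    rintro _ ⟨φ, a, m, rfl⟩
    have h : (End.of ((a.asHom ≫ φ) ≫ ψ)) • m = (End.of (φ ≫ ψ)) • (a • m) := by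
      rw [smul_smul, End.mul_def, Category.assoc]
    simpa [Linear.rightComp, sub_eq_zero] using h

lemma evalAgainst_comp_endTensorMap {X Y : D} (α : X ⟶ Y) (ψ : Y ⟶ E) :
    evalAgainst k E W ψ ∘ₗ endTensorMap k E W α = evalAgainst k E W (α ≫ ψ) := by
  refine Submodule.linearMap_qext _ (TensorProduct.ext' fun φ m => ?_)
  simp [endTensorMap, evalAgainst, Linear.rightComp]

/-- The submodule `J_{E,W}(X)` of `L_{E,W}(X)`: an element `∑ φᵢ ⊗ wᵢ` of `L_{E,W}(X)` belongs to
`J_{E,W}(X)` if and only if `∑ (ψ ∘ φᵢ) • wᵢ = 0` for all `ψ : X ⟶ E`. -/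
def submoduleJ (X : D) : Submodule k (EndTensor k E W X) :=
  ⨅ ψ : X ⟶ E, LinearMap.ker (evalAgainst k E W ψ)

lemma mem_submoduleJ {X : D} (x : EndTensor k E W X) :
    x ∈ submoduleJ k E W X ↔ ∀ ψ : X ⟶ E, evalAgainst k E W ψ x = 0 := by
  simp [submoduleJ]

lemma endTensorMap_mem_submoduleJ {X Y : D} (α : X ⟶ Y) {x : EndTensor k E W X}
    (hx : x ∈ submoduleJ k E W X) : endTensorMap k E W α x ∈ submoduleJ k E W Y := by
  rw [mem_submoduleJ] at hx ⊢
  intro ψ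
  rw [← hx (α ≫ ψ), ← evalAgainst_comp_endTensorMap, LinearMap.comp_apply]

/-- The subfunctor `J_{E,W}` of `L_{E,W}`. -/
def inducedSubfunctorJ : ModSubfunctor (inducedFunctorL k E W) where
  obj X := submoduleJ k E W X
  map_mem α _ hx := endTensorMap_mem_submoduleJ k E W α hx

end Induction

/-! ### The category of finite sets and correspondences -/

/-- The objects of the category of finite sets and correspondences. -/
structure FinCorr : Type (u + 1) where
  /-- The underlying set. -/
  carrier : Type u
  [finite : Finite carrier]

namespace FinCorr

instance : CoeSort FinCorr.{u} (Type u) := ⟨FinCorr.carrier⟩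

attribute [instance] FinCorr.finite

/-- The morphisms from `X` to `Y` are the correspondences, i.e. the subsets of `Y × X`. The
composite of `S ⊆ Y × X` followed by `R ⊆ Z × Y` is the set of all `(z, x)` such that
`(z, y) ∈ R` and `(y, x) ∈ S` for some `y`. -/
instance : Category.{u} FinCorr.{u} where
  Hom X Y := Set (Y × X)
  id X := {p | p.1 = p.2}
  comp {X Y Z} S R := {p | ∃ y : Y, (p.1, y) ∈ R ∧ (y, p.2) ∈ S}
  id_comp S := by ext ⟨y, x⟩; simp
  comp_id S := by ext ⟨y, x⟩; simp
  assoc S R Q := by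
    ext ⟨y, x⟩
    constructor
    · rintro ⟨c, hc, b, hb, ha⟩
      exact ⟨b, ⟨c, hc, hb⟩, ha⟩
    · rintro ⟨b, ⟨c, hc, hb⟩, ha⟩
      exact ⟨c, hc, b, hb, ha⟩

end FinCorr

/-- The `k`-linearization of the category of finite sets and correspondences. A correspondence
functor over `k` is a `k`-linear functor from this category to `k`-modules, and a morphism of
correspondence functors is a natural transformation. -/
abbrev LinCorr (k : Type v) [CommRing k] := Free k FinCorr.{u}

/-- A finite set, as an object of the linearized category of correspondences. -/
abbrev LinCorr.of (k : Type v) [CommRing k] (X : Type u) [Finite X] : LinCorr.{u, v} k :=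
  Free.of k (FinCorr.mk X)

/-- A correspondence `Q ⊆ Y × X`, as a morphism from `X` to `Y` in the linearized category. -/
def LinCorr.corr (k : Type v) [CommRing k] {X Y : Type u} [Finite X] [Finite Y]
    (Q : Set (Y × X)) : LinCorr.of k X ⟶ LinCorr.of k Y :=
  (Free.embedding k FinCorr).map (X := FinCorr.mk X) (Y := FinCorr.mk Y) Q

/-! ### The algebra of relations, the algebra of permuted orders, the fundamental functor -/

section Fundamental

variable (k : Type v) [CommRing k] (E : Type u) [Finite E]

/-- The algebra `k𝒞(E, E)` of all relations on `E`. -/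
abbrev RelAlg : Type (max u v) := End (LinCorr.of k E)

/-- A relation on `E`, as an element of the algebra of relations. -/
def RelAlg.rel {E : Type u} [Finite E] (Q : Set (E × E)) : RelAlg k E := LinCorr.corr k Q

/-- A relation on `E` is inessential if it factors through a set with fewer elements than `E`. -/
def IsInessential {E : Type u} [Finite E] (Q : Set (E × E)) : Prop :=
  ∃ (Y : FinCorr.{u}) (S : FinCorr.mk E ⟶ Y) (R : Y ⟶ FinCorr.mk E),
    Nat.card Y < Nat.card E ∧ S ≫ R = Q

/-- The two-sided ideal `I_E` of `k𝒞(E, E)` generated by the inessential relations. The quotient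
by this ideal is the essential algebra. -/
def inessentialIdeal : TwoSidedIdeal (RelAlg k E) :=
  TwoSidedIdeal.span {a | ∃ Q : Set (E × E), IsInessential Q ∧ a = RelAlg.rel k Q}

/-- The transitive closure of a relation. -/
def transClosure {E : Type u} (Q : Set (E × E)) : Set (E × E) :=
  {p | Relation.TransGen (fun a b => (a, b) ∈ Q) p.1 p.2}

/-- The two-sided ideal of `k𝒞(E, E)` generated by the differences `S - S̄`, where `S` is a
reflexive relation on `E` and `S̄` is its transitive closure. Its image in the essential algebra
is the nilpotent ideal `N` which defines the algebra of permuted orders. -/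
def closureIdeal : TwoSidedIdeal (RelAlg k E) :=
  TwoSidedIdeal.span {a | ∃ S : Set (E × E), (∀ e, (e, e) ∈ S) ∧
    a = RelAlg.rel k S - RelAlg.rel k (transClosure S)}

/-- The algebra `𝒫_E` of permuted orders: the quotient of the essential algebra `k𝒞(E, E) / I_E`
by the image `N` of the ideal generated by all the `S - S̄`. -/
abbrev PermOrderAlg : Type (max u v) :=
  (inessentialIdeal k E ⊔ closureIdeal k E).ringCon.Quotient

/-- The canonical surjection `k𝒞(E, E) → 𝒫_E`. -/
def PermOrderAlg.proj : RelAlg k E →+* PermOrderAlg k E :=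
  (inessentialIdeal k E ⊔ closureIdeal k E).ringCon.mk'

/-- The order relations on `E`, ordered by inclusion; `(a, b) ∈ R` means `a ≤ b` for `R`. -/
abbrev OrderRel (E : Type u) : Type u :=
  {R : Set (E × E) // (∀ a, (a, a) ∈ R) ∧ (∀ a b, (a, b) ∈ R → (b, a) ∈ R → a = b) ∧
    ∀ a b c, (a, b) ∈ R → (b, c) ∈ R → (a, c) ∈ R}

variable {E}

open Classical in
/-- The idempotent `f_R = ∑_{S ⊇ R} μ(R, S) S` of `𝒫_E` associated with an order `R` on `E`, where
`S` runs over the orders on `E` containing `R`, and `μ` is the Möbius function of the poset of all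
orders on `E`. -/
def fundIdempotent (R : OrderRel E) : PermOrderAlg k E :=
  letI : Fintype (OrderRel E) := Fintype.ofFinite _
  letI : LocallyFiniteOrder (OrderRel E) := Fintype.toLocallyFiniteOrder
  ∑ S : OrderRel E, if R ≤ S then
    IncidenceAlgebra.mu k R S • PermOrderAlg.proj k E (RelAlg.rel k S.1) else 0

/-- The fundamental module `𝒫_E f_R`: the left ideal of `𝒫_E` generated by `f_R`. -/
def FundModule (R : OrderRel E) : Type (max u v) :=
  ↥(Ideal.span {fundIdempotent k R} : Ideal (PermOrderAlg k E))

instance (R : OrderRel E) : AddCommGroup (FundModule k R) :=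
  inferInstanceAs (AddCommGroup ↥(Ideal.span {fundIdempotent k R} : Ideal (PermOrderAlg k E)))

instance (R : OrderRel E) : Module (PermOrderAlg k E) (FundModule k R) :=
  inferInstanceAs
    (Module (PermOrderAlg k E) ↥(Ideal.span {fundIdempotent k R} : Ideal (PermOrderAlg k E)))

instance (R : OrderRel E) : Module k (FundModule k R) :=
  inferInstanceAs (Module k ↥(Ideal.span {fundIdempotent k R} : Ideal (PermOrderAlg k E)))

/-- The action of relations on the fundamental module, through `k𝒞(E, E) → 𝒫_E`. -/
instance (R : OrderRel E) : Module (RelAlg k E) (FundModule k R) :=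
  Module.compHom (FundModule k R) (PermOrderAlg.proj k E)

instance (R : OrderRel E) : IsScalarTower k (RelAlg k E) (FundModule k R) where
  smul_assoc c a m := by
    have h : PermOrderAlg.proj k E (c • a) = c • PermOrderAlg.proj k E a := rfl
    have h' : (c • a) • m = PermOrderAlg.proj k E (c • a) • m := rfl
    rw [h', h]
    exact Subtype.ext (smul_mul_assoc c (PermOrderAlg.proj k E a) m.1)

/-- The fundamental functor `𝕊_{E,R} = L_{E,𝒫_E f_R} / J_{E,𝒫_E f_R}` associated with a finite
poset `(E, R)`. -/
def fundamentalFunctor (R : OrderRel E) : LinCorr.{u, v} k ⥤ ModuleCat.{max u v} k :=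
  (inducedSubfunctorJ k (LinCorr.of k E) (FundModule k R)).quotient

instance (R : OrderRel E) : (fundamentalFunctor k R).Additive := by
  unfold fundamentalFunctor; infer_instance

instance (R : OrderRel E) : (fundamentalFunctor k R).Linear k := by
  unfold fundamentalFunctor; infer_instance

end Fundamental

/-! ### The functor associated with a lattice -/

section Lattice

variable (k : Type v) [CommRing k]

/-- The action of a correspondence `Q ⊆ Y × X` on a map `φ : X → T`:
`(Qφ)(y)` is the join of all `φ(x)` with `(y, x) ∈ Q`. -/
def corrAct {T : Type u} [SemilatticeSup T] [OrderBot T] {X Y : Type u} [Finite X]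
    (Q : Set (Y × X)) (φ : X → T) : Y → T :=
  fun y => (Set.toFinite {x | (y, x) ∈ Q}).toFinset.sup φ

lemma corrAct_le_iff {T : Type u} [SemilatticeSup T] [OrderBot T] {X Y : Type u} [Finite X]
    (Q : Set (Y × X)) (φ : X → T) (y : Y) (t : T) :
    corrAct Q φ y ≤ t ↔ ∀ x, (y, x) ∈ Q → φ x ≤ t := by
  simp [corrAct]

lemma corrAct_id {T : Type u} [SemilatticeSup T] [OrderBot T] {X : Type u} [Finite X]
    (φ : X → T) : corrAct {p : X × X | p.1 = p.2} φ = φ := by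
  funext y
  refine eq_of_forall_ge_iff fun t => ?_
  simp [corrAct_le_iff]

lemma corrAct_comp {T : Type u} [SemilatticeSup T] [OrderBot T] {X Y Z : Type u} [Finite X]
    [Finite Y] (R : Set (Z × Y)) (S : Set (Y × X)) (φ : X → T) :
    corrAct {p : Z × X | ∃ y : Y, (p.1, y) ∈ R ∧ (y, p.2) ∈ S} φ = corrAct R (corrAct S φ) := by
  funext z
  refine eq_of_forall_ge_iff fun t => ?_
  simp only [corrAct_le_iff]
  exact ⟨fun h y hy x hx => h x ⟨y, hy, hx⟩, fun h x ⟨y, hy, hx⟩ => h y hy x hx⟩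

/-- The `k`-linear extension of the action of correspondences on maps to `T`, as a linear map from
`k𝒞(Y, X)` to the linear maps `F_T(X) → F_T(Y)`. -/
def corrActLin (T : Type u) [SemilatticeSup T] [OrderBot T] (X Y : LinCorr.{u, v} k) :
    (X ⟶ Y) →ₗ[k] ((FinCorr.carrier X → T) →₀ k) →ₗ[k] ((FinCorr.carrier Y → T) →₀ k) :=
  haveI : Finite (FinCorr.carrier X) := FinCorr.finite X
  Finsupp.linearCombination k
    (fun Q : Set (FinCorr.carrier Y × FinCorr.carrier X) =>
      Finsupp.lmapDomain k k (corrAct (T := T) Q))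

lemma corrActLin_single (T : Type u) [SemilatticeSup T] [OrderBot T] {X Y : FinCorr.{u}}
    (Q : X ⟶ Y) (r s : k) (φ : X → T) :
    corrActLin k T (Free.of k X) (Free.of k Y) (Finsupp.single Q r) (Finsupp.single φ s) =
      Finsupp.single (corrAct Q φ) (r * s) := by
  refine (LinearMap.congr_fun (Finsupp.linearCombination_single k r Q) _).trans ?_
  exact (congrArg (r • ·) Finsupp.mapDomain_single).trans (Finsupp.smul_single r _ s)

lemma corrActLin_id (T : Type u) [SemilatticeSup T] [OrderBot T] (X : LinCorr.{u, v} k) :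
    corrActLin k T X X (𝟙 X) = LinearMap.id := by
  refine Finsupp.lhom_ext fun φ s => ?_
  refine (corrActLin_single k T (@CategoryStruct.id FinCorr.{u} _ X) 1 s φ).trans ?_
  have : Finite (FinCorr.carrier X) := FinCorr.finite X
  rw [one_mul]
  exact congrArg (Finsupp.single · s) (corrAct_id φ)

lemma corrActLin_comp (T : Type u) [SemilatticeSup T] [OrderBot T] {X Y Z : LinCorr.{u, v} k}
    (α : X ⟶ Y) (β : Y ⟶ Z) :
    corrActLin k T X Z (α ≫ β) = corrActLin k T Y Z β ∘ₗ corrActLin k T X Y α := by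
  induction α using Finsupp.induction_linear with
  | zero => exact (congrArg _ (Limits.zero_comp)).trans (by rw [map_zero]; erw [map_zero]; simp)
  | add f g hf hg =>
    refine (congrArg _ (Preadditive.add_comp X Y Z f g β)).trans ?_
    rw [map_add, hf, hg, ← LinearMap.comp_add]
    exact congrArg _ (map_add (corrActLin k T X Y) f g).symm
  | single S r =>
    induction β using Finsupp.induction_linear with
    | zero => exact (congrArg _ (Limits.comp_zero)).trans (by rw [map_zero]; erw [map_zero]; simp)
    | add f g hf hg =>
      refine (congrArg _ (Preadditive.comp_add X Y Z _ f g)).trans ?_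
      rw [map_add, hf, hg, ← LinearMap.add_comp]
      exact congrArg (· ∘ₗ _) (map_add (corrActLin k T Y Z) f g).symm
    | single R s =>
      refine Finsupp.lhom_ext fun φ t => ?_
      refine (congrArg (fun γ => corrActLin k T X Z γ (Finsupp.single φ t))
        (Free.single_comp_single k FinCorr S R r s)).trans ?_
      refine (corrActLin_single k T _ _ _ _).trans ?_
      refine Eq.trans ?_ (congrArg (corrActLin k T Y Z _) (corrActLin_single k T S r t φ)).symm
      refine Eq.trans ?_ (corrActLin_single k T R s _ _).symm
      have : Finite (FinCorr.carrier X) := FinCorr.finite X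
      have : Finite (FinCorr.carrier Y) := FinCorr.finite Y
      rw [show r * s * t = s * (r * t) by ring]
      exact congrArg (Finsupp.single · _) (corrAct_comp R S φ)

/-- The functor `F_T`: its value at `X` is the free `k`-module on the set of all maps `X → T`, and
correspondences act by the `k`-linear extension of `corrAct`. -/
def latticeFunctor (T : Type u) [SemilatticeSup T] [OrderBot T] :
    LinCorr.{u, v} k ⥤ ModuleCat.{max u v} k where
  obj X := ModuleCat.of k ((FinCorr.carrier X → T) →₀ k)
  map {X Y} α := ModuleCat.ofHom (corrActLin k T X Y α)
  map_id X := ModuleCat.hom_ext (corrActLin_id k T X)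
  map_comp α β := ModuleCat.hom_ext (corrActLin_comp k T α β)

instance (T : Type u) [SemilatticeSup T] [OrderBot T] :
    (latticeFunctor.{u, v} k T).Additive where
  map_add {X Y f g} := ModuleCat.hom_ext (map_add (corrActLin k T X Y) f g)

instance (T : Type u) [SemilatticeSup T] [OrderBot T] :
    (latticeFunctor.{u, v} k T).Linear k where
  map_smul {X Y} f r := ModuleCat.hom_ext (map_smul (corrActLin k T X Y) r f)

variable (T : Type u) [Lattice T] [BoundedOrder T] [Finite T]

/-- The set of irreducible elements of a lattice. -/
abbrev Irr (T : Type u) [Lattice T] : Type u := {e : T // SupIrred e}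

/-- The order relation on the full subposet of irreducible elements. -/
def irrOrder (T : Type u) [Lattice T] : OrderRel (Irr T) :=
  ⟨{p | p.1 ≤ p.2}, fun _ => le_refl _, fun _ _ h₁ h₂ => le_antisymm h₁ h₂,
    fun _ _ _ h₁ h₂ => le_trans h₁ h₂⟩

variable {T}

/-- The join of all the elements of `T` strictly smaller than `t`. -/
def rElem (t : T) : T := (Set.toFinite {s | s < t}).toFinset.sup id

open Classical in
/-- The map `η_A : E → T` equal to `r(e)` for `e ∈ A` and to `e` for `e ∉ A`. -/
def etaMap (A : Finset (Irr T)) : Irr T → T :=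
  fun e => if e ∈ A then rElem e.1 else e.1

variable (T)

/-- The element `γ_T = ∑_{A ⊆ E} (-1)^|A| η_A°` of `F_{T^op}(E)`. -/
def gammaElem : (latticeFunctor k Tᵒᵈ).obj (LinCorr.of k (Irr T)) :=
  letI : Fintype (Irr T) := Fintype.ofFinite _
  (∑ A : Finset (Irr T),
    Finsupp.single (fun e => OrderDual.toDual (etaMap A e)) ((-1 : k) ^ A.card) :
      (Irr T → Tᵒᵈ) →₀ k)

end Lattice

end

/-! Both functors are quotients of `Hom(E, -)`: a morphism α goes to α ⋆ γ_T on one side and to the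
class of α ⊗ f_R on the other. It therefore suffices that α ⋆ γ_T = 0 exactly when (ψα) f_R = 0 in
𝒫_E for every ψ : X → E (`nonempty_generatedBy_iso`).

Vanishing in F_{T^op}(X) is detected by the pairing with ⟨φ, ψ⟩ = 1 if φ ≤ ψ and 0 otherwise: it is
unitriangular, and Q ⋆ - is adjoint to the action of Q^op on maps to T. The alternating sum γ_T
pairs to 1 with the inclusion ι : E → T and to 0 with every other map (`latticePairing_gammaElem`).
Hence α ⋆ γ_T = 0 if and only if, for each φ : X → T, the coefficients in α of the Q with Q^op φ = ι
add up to zero (`gammaMap_eq_zero_iff`). Every φ has the form U^op ι, because elements of T are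
joins of irreducibles; this reduces the claim to X = E (`gammaMap_eq_zero_of_comp`).

On E, the annihilator of ⟨γ_T⟩(E) contains both ideals defining 𝒫_E, and a lift of f_R fixes γ_T
(`exists_lift_fundIdempotent`), so a f_R = 0 forces a ⋆ γ_T = 0. Conversely, a f_R is the sum over
permutations τ of τ f_R weighted by ⟨ι ∘ τ, a ⋆ γ_T⟩ (`proj_mul_fundIdempotent_eq_sum`), so it
vanishes with a ⋆ γ_T. -/

noncomputable section

/-- Two surjections with the same kernel have isomorphic targets. -/
lemma exists_linearEquiv_of_ker_eq {k M N P : Type*} [Ring k] [AddCommGroup M] [AddCommGroup N]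
    [AddCommGroup P] [Module k M] [Module k N] [Module k P] (p : M →ₗ[k] N) (q : M →ₗ[k] P)
    (hp : Function.Surjective p) (hq : Function.Surjective q)
    (h : LinearMap.ker p = LinearMap.ker q) :
    ∃ e : N ≃ₗ[k] P, ∀ m, e (p m) = q m := by
  refine ⟨(p.quotKerEquivOfSurjective hp).symm ≪≫ₗ Submodule.quotEquivOfEq _ _ h ≪≫ₗ
    q.quotKerEquivOfSurjective hq, fun m => ?_⟩
  have : (p.quotKerEquivOfSurjective hp).symm (p m) = Submodule.Quotient.mk m := by
    rw [LinearEquiv.symm_apply_eq]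
    rfl
  simp only [LinearEquiv.trans_apply, this]
  rfl

/-! ### Cyclic subfunctors and L/J as quotients of a representable functor. -/

section Generated

variable {k : Type v} [CommRing k] {D : Type u} [Category.{w} D] [Preadditive D] [Linear k D]
  {F : D ⥤ ModuleCat.{w} k} [F.Additive] [F.Linear k] {E : D}

/-- The map `Hom(E, X) → F(X)` corresponding to `x ∈ F(E)` by the Yoneda lemma. -/
def evalAt (x : F.obj E) (X : D) : (E ⟶ X) →ₗ[k] F.obj X where
  toFun α := (F.map α).hom x
  map_add' α β := by rw [F.map_add]; rfl
  map_smul' r α := by rw [F.map_smul]; rfl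

/-- The ranges form a subfunctor containing `x`, by functoriality and the identity of `E`, and any
subfunctor containing `x` contains them. -/
lemma generatedBy_obj_eq_range (x : F.obj E) (X : D) :
    (ModSubfunctor.generatedBy F x).obj X = LinearMap.range (evalAt x X) := by
  apply le_antisymm
  · refine iInf₂_le (⟨fun Y => LinearMap.range (evalAt x Y), ?_⟩ : ModSubfunctor F) ?_
    · rintro Y Z f _ ⟨α, rfl⟩
      exact ⟨α ≫ f, by simp [evalAt]⟩
    · exact ⟨𝟙 E, by simp [evalAt]⟩
  · rintro _ ⟨α, rfl⟩
    simp only [ModSubfunctor.generatedBy, Submodule.mem_iInf]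
    exact fun G hG => G.map_mem α hG

variable {W : Type w} [AddCommGroup W] [Module k W] [Module (End E) W] [IsScalarTower k (End E) W]

/-- The map `Hom(E, X) → L_{E,W}(X) / J_{E,W}(X)` sending `φ` to the class of `φ ⊗ w`. -/
def tensorClass (m : W) (X : D) : (E ⟶ X) →ₗ[k] (inducedSubfunctorJ k E W).quotient.obj X :=
  (submoduleJ k E W X).mkQ ∘ₗ (balancingSubmodule k E W X).mkQ ∘ₗ
    (TensorProduct.mk k (E ⟶ X) W).flip m

lemma tensorClass_eq_zero_iff (m : W) {X : D} (α : E ⟶ X) :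
    tensorClass (k := k) m X α = 0 ↔ ∀ ψ : X ⟶ E, End.of (α ≫ ψ) • m = 0 := by
  refine (Submodule.Quotient.mk_eq_zero _).trans ?_
  rw [mem_submoduleJ]
  rfl

/-- When `m` generates `W`, any φ ⊗ (a • m) can be rewritten as (φa) ⊗ m. -/
lemma tensorClass_surjective {m : W} (hm : ∀ x : W, ∃ a : End E, x = a • m) (X : D) :
    Function.Surjective (tensorClass (k := k) (E := E) m X) := by
  let q : (E ⟶ X) ⊗[k] W →ₗ[k] (inducedSubfunctorJ k E W).quotient.obj X :=
    (submoduleJ k E W X).mkQ ∘ₗ (balancingSubmodule k E W X).mkQ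
  have hq (y) : ∃ α, tensorClass (k := k) m X α = q y := by
    induction y using TensorProduct.induction_on with
    | zero => exact ⟨0, by rw [map_zero, map_zero]⟩
    | add a b ha hb =>
      obtain ⟨a', ha⟩ := ha
      obtain ⟨b', hb⟩ := hb
      exact ⟨a' + b', by rw [map_add, ha, hb, map_add]⟩
    | tmul φ x =>
      obtain ⟨a, rfl⟩ := hm x
      refine ⟨a.asHom ≫ φ, ?_⟩
      refine congrArg (submoduleJ k E W X).mkQ ?_
      exact (Submodule.Quotient.eq _).2 (Submodule.subset_span ⟨φ, a, m, rfl⟩)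
  intro y
  obtain ⟨y, rfl⟩ := Submodule.mkQ_surjective _ y
  obtain ⟨y, rfl⟩ := Submodule.mkQ_surjective _ y
  exact hq y

lemma quotient_map_tensorClass (m : W) {X Y : D} (f : X ⟶ Y) (α : E ⟶ X) :
    ((inducedSubfunctorJ k E W).quotient.map f).hom (tensorClass m X α) =
      tensorClass m Y (α ≫ f) := rfl

/-- A cyclic subfunctor of `F` is isomorphic to `L_{E,W} / J_{E,W}` if `W` is generated by an
element whose induced annihilators agree with those of the generator. -/
theorem nonempty_generatedBy_iso (x : F.obj E) {m : W} (hm : ∀ y : W, ∃ a : End E, y = a • m)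
    (h : ∀ (X : D) (α : E ⟶ X),
      (F.map α).hom x = 0 ↔ ∀ ψ : X ⟶ E, End.of (α ≫ ψ) • m = 0) :
    Nonempty ((ModSubfunctor.generatedBy F x).toFunctor ≅
      (inducedSubfunctorJ k E W).quotient) := by
  have hmem (X : D) (α : E ⟶ X) : evalAt x X α ∈ (ModSubfunctor.generatedBy F x).obj X := by
    rw [generatedBy_obj_eq_range]
    exact ⟨α, rfl⟩
  have key (X : D) := exists_linearEquiv_of_ker_eq
    ((evalAt x X).codRestrict ((ModSubfunctor.generatedBy F x).obj X) (hmem X))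
    (tensorClass m X)
    (by
      rintro ⟨y, hy⟩
      rw [generatedBy_obj_eq_range] at hy
      obtain ⟨α, rfl⟩ := hy
      exact ⟨α, rfl⟩)
    (tensorClass_surjective hm X)
    (by
      ext α
      rw [LinearMap.ker_codRestrict, LinearMap.mem_ker, LinearMap.mem_ker,
        tensorClass_eq_zero_iff, ← h]
      rfl)
  choose e he using key
  refine ⟨NatIso.ofComponents (fun X => (e X).toModuleIso) fun {X Y} f => ?_⟩
  refine ModuleCat.hom_ext (LinearMap.ext ?_)
  rintro ⟨y, hy⟩
  rw [generatedBy_obj_eq_range] at hy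
  obtain ⟨α, rfl⟩ := hy
  refine Eq.trans ?_ (((quotient_map_tensorClass m f α).symm).trans
    (congrArg ((inducedSubfunctorJ k E W).quotient.map f).hom (he X α).symm))
  refine Eq.trans ?_ (he Y (α ≫ f))
  refine congrArg (e Y) (Subtype.ext ?_)
  exact (congrArg (fun g => g.hom x) (F.map_comp α f)).symm

end Generated

/-! ### The pairing between maps to T and F_{T^op}, and its value on γ_T. -/

section Pairing

/-- The opposite of a correspondence. -/
def oppCorr {X Y : Type u} (Q : Set (Y × X)) : Set (X × Y) := {p | (p.2, p.1) ∈ Q}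

@[simp] lemma mem_oppCorr {X Y : Type u} (Q : Set (Y × X)) (x : X) (y : Y) :
    (x, y) ∈ oppCorr Q ↔ (y, x) ∈ Q := Iff.rfl

variable (k : Type v) [CommRing k] {T : Type u} [Lattice T]

open Classical in
/-- The linear form on `F_{T^op}(X)` sending `ψ` to `1` if `φ ≤ ψ` in `T`, and to `0` otherwise. -/
def latticePairing {X : Type u} (φ : X → T) : ((X → Tᵒᵈ) →₀ k) →ₗ[k] k :=
  Finsupp.linearCombination k fun ψ => if ∀ x, φ x ≤ OrderDual.ofDual (ψ x) then 1 else 0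

open Classical in
lemma latticePairing_single {X : Type u} (φ : X → T) (ψ : X → Tᵒᵈ) (r : k) :
    latticePairing k φ (Finsupp.single ψ r) =
      if ∀ x, φ x ≤ OrderDual.ofDual (ψ x) then r else 0 := by
  simp [latticePairing]

lemma eq_zero_of_latticePairing_eq_zero {X : Type u} {v : (X → Tᵒᵈ) →₀ k}
    (h : ∀ φ : X → T, latticePairing k φ v = 0) : v = 0 := by
  classical
  by_contra hv
  -- Minimal for the order of T^op means maximal for T, so pairing `v` with `ψ` itself isolates the
  -- coefficient of `ψ`.
  obtain ⟨ψ, hψ⟩ := v.support.exists_minimal (Finsupp.support_nonempty_iff.2 hv)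
  refine Finsupp.mem_support_iff.1 hψ.prop ?_
  rw [← h fun x => OrderDual.ofDual (ψ x), latticePairing, Finsupp.linearCombination_apply,
    Finsupp.sum, Finset.sum_eq_single_of_mem ψ hψ.prop]
  · simp
  · intro χ hχ hne
    rw [if_neg, smul_zero]
    exact fun hle => hne (le_antisymm hle (hψ.le_of_le hχ hle))

variable [BoundedOrder T]

/-- Adjunction between Q^op acting by joins and Q acting by meets: both sides say φ(y) ≤ ψ(x) for
all (y, x) ∈ Q. -/
lemma le_corrAct_dual_iff {X Y : Type u} [Finite X] [Finite Y] (Q : Set (Y × X)) (ψ : X → Tᵒᵈ)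
    (φ : Y → T) :
    (∀ y, φ y ≤ OrderDual.ofDual (corrAct Q ψ y)) ↔
      ∀ x, corrAct (oppCorr Q) φ x ≤ OrderDual.ofDual (ψ x) := by
  have h (y) : φ y ≤ OrderDual.ofDual (corrAct Q ψ y) ↔
      ∀ x, (y, x) ∈ Q → φ y ≤ OrderDual.ofDual (ψ x) :=
    corrAct_le_iff Q ψ y (OrderDual.toDual (φ y))
  simp only [h, corrAct_le_iff, mem_oppCorr]
  exact ⟨fun H x y hy => H y x hy, fun H y x hx => H x y hx⟩

lemma corrAct_oppCorr_comp {X Y Z : Type u} [Finite X] [Finite Y] [Finite Z]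
    (Q : Set (Y × X)) (U : Set (Z × Y)) (φ : Z → T) :
    corrAct (oppCorr {p : Z × X | ∃ y : Y, (p.1, y) ∈ U ∧ (y, p.2) ∈ Q}) φ =
      corrAct (oppCorr Q) (corrAct (oppCorr U) φ) := by
  rw [← corrAct_comp]
  congr 1
  ext ⟨x, z⟩
  exact exists_congr fun y => and_comm

variable [Finite T]

/-- Irreducibility keeps the join of all elements below `e` strictly below `e`. -/
lemma le_rElem_iff {e : T} (he : SupIrred e) {t : T} : t ≤ rElem e ↔ t < e := by
  have h : ∀ s < e, s ≤ rElem e := fun s hs =>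
    Finset.le_sup (f := id) (by simpa using hs)
  refine ⟨fun ht => lt_of_le_of_lt ht (lt_of_le_of_ne ?_ fun heq => ?_), h t⟩
  · exact Finset.sup_le fun s hs => le_of_lt (by simpa using hs)
  · obtain ⟨s, hs, rfl⟩ := he.finset_sup_eq heq
    simp at hs

open Classical in
lemma latticePairing_gammaElem (χ : Irr T → T) :
    latticePairing k χ (gammaElem k T) = if χ = Subtype.val then 1 else 0 := by
  let : Fintype (Irr T) := Fintype.ofFinite _
  have h : latticePairing k χ (gammaElem k T) = ∑ A : Finset (Irr T),
      if ∀ e, χ e ≤ etaMap A e then (-1 : k) ^ A.card else 0 := by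
    refine (map_sum (latticePairing k χ) _ _).trans (Finset.sum_congr rfl fun A _ => ?_)
    refine (latticePairing_single k χ _ _).trans ?_
    congr
  -- Each factor is the indicator of χ(e) = e; expanding the product over subsets A recovers the
  -- alternating sum.
  have h2 : ∏ e : Irr T, ((-if χ e < e.1 then (1 : k) else 0) + if χ e ≤ e.1 then 1 else 0) =
      if χ = Subtype.val then 1 else 0 := by
    split_ifs with hχ
    · subst hχ
      simp
    · obtain ⟨e, he⟩ := Function.ne_iff.1 hχ
      refine Finset.prod_eq_zero (Finset.mem_univ e) ?_
      by_cases hle : χ e ≤ e.1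
      · rw [if_pos hle, if_pos (lt_of_le_of_ne hle he)]
        ring
      · rw [if_neg hle, if_neg fun h => hle h.le]
        ring
  rw [h]
  refine Eq.trans ?_ (h2.trans (by congr))
  rw [Finset.prod_add, ← Finset.powerset_univ]
  refine Finset.sum_congr rfl fun A _ => ?_
  rw [Finset.prod_neg, mul_assoc, Finset.prod_ite_zero, Finset.prod_ite_zero]
  have hiff : (∀ e, χ e ≤ etaMap A e) ↔
      (∀ e ∈ A, χ e < e.1) ∧ ∀ e ∈ Finset.univ \ A, χ e ≤ e.1 := by
    constructor
    · refine fun H => ⟨fun e he => ?_, fun e he => ?_⟩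
      · have := H e
        rwa [etaMap, if_pos he, le_rElem_iff e.2] at this
      · have := H e
        rwa [etaMap, if_neg (by simpa using he)] at this
    · rintro ⟨h1, h2⟩ e
      rw [etaMap]
      split_ifs with he
      · exact (le_rElem_iff e.2).2 (h1 e he)
      · exact h2 e (by simpa using he)
  rw [Finset.prod_const_one, Finset.prod_const_one]
  split_ifs <;> first | tauto | ring

open Classical in
/-- The linear form on `k𝒞(X, E)` sending `Q` to `1` if `Q^op φ` is the inclusion `E → T`, and to
`0` otherwise. -/
def inclusionForm {X : FinCorr.{u}} (φ : X → T) :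
    (LinCorr.of k (Irr T) ⟶ Free.of k X) →ₗ[k] k :=
  Finsupp.linearCombination k fun Q : Set (X × Irr T) =>
    if corrAct (oppCorr Q) φ = Subtype.val then 1 else 0

open Classical in
lemma inclusionForm_single {X : FinCorr.{u}} (φ : X → T) (Q : Set (X × Irr T)) (r : k) :
    inclusionForm k φ (Finsupp.single Q r) =
      if corrAct (oppCorr Q) φ = Subtype.val then r else 0 := by
  refine (Finsupp.linearCombination_single k r Q).trans ?_
  simp

/-- The map `k𝒞(X, E) → F_{T^op}(X)` sending `α` to `α ⋆ γ_T`. -/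
abbrev gammaMap (T : Type u) [Lattice T] [BoundedOrder T] [Finite T] (X : LinCorr.{u, v} k) :
    (LinCorr.of k (Irr T) ⟶ X) →ₗ[k] (latticeFunctor k Tᵒᵈ).obj X :=
  evalAt (F := latticeFunctor k Tᵒᵈ) (gammaElem k T) X

/-- By adjunction Q moves to the other side of the pairing, where γ_T only detects the inclusion. -/
lemma latticePairing_gammaMap {X : FinCorr.{u}} (φ : X → T)
    (α : LinCorr.of k (Irr T) ⟶ Free.of k X) :
    latticePairing k φ (gammaMap k T (Free.of k X) α) = inclusionForm k φ α := by
  classical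
  suffices h : (latticePairing k φ ∘ₗ gammaMap k T (Free.of k X) :
      (LinCorr.of k (Irr T) ⟶ Free.of k X) →ₗ[k] k) = inclusionForm k φ from
    LinearMap.congr_fun h α
  refine Finsupp.lhom_ext fun (Q : Set (X × Irr T)) r => ?_
  refine Eq.trans ?_ (inclusionForm_single k φ Q r).symm
  have h : latticePairing k φ ∘ₗ (corrActLin k Tᵒᵈ (LinCorr.of k (Irr T)) (Free.of k X)
      (Finsupp.single Q r) : ((Irr T → Tᵒᵈ) →₀ k) →ₗ[k] ((X → Tᵒᵈ) →₀ k)) =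
      r • latticePairing k (corrAct (oppCorr Q) φ) := by
    refine Finsupp.lhom_ext fun (ψ : Irr T → Tᵒᵈ) s => ?_
    refine (congrArg (latticePairing k φ) (corrActLin_single k Tᵒᵈ (X := FinCorr.mk (Irr T))
      (Y := X) Q r s ψ)).trans ?_
    change latticePairing k φ (Finsupp.single (corrAct Q ψ) (r * s)) =
      r * latticePairing k (corrAct (oppCorr Q) φ) (Finsupp.single ψ s)
    rw [latticePairing_single, latticePairing_single, mul_ite, mul_zero]
    exact if_congr (le_corrAct_dual_iff Q ψ φ) rfl rfl
  refine (LinearMap.congr_fun h (gammaElem k T)).trans ?_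
  change r * latticePairing k (corrAct (oppCorr Q) φ) (gammaElem k T) = _
  rw [latticePairing_gammaElem]
  simp

lemma gammaMap_eq_zero_iff {X : FinCorr.{u}} (α : LinCorr.of k (Irr T) ⟶ Free.of k X) :
    gammaMap k T (Free.of k X) α = 0 ↔ ∀ φ : X → T, inclusionForm k φ α = 0 := by
  simp only [← latticePairing_gammaMap]
  refine ⟨fun h φ => ?_, eq_zero_of_latticePairing_eq_zero k⟩
  rw [h]
  exact map_zero _

lemma inclusionForm_comp_single {X Y : FinCorr.{u}} (φ : Y → T)
    (α : LinCorr.of k (Irr T) ⟶ Free.of k X) (U : Set (Y × X)) :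
    inclusionForm k φ (α ≫ (Free.embedding k FinCorr).map (X := X) (Y := Y) U) =
      inclusionForm k (corrAct (oppCorr U) φ) α := by
  classical
  suffices h : inclusionForm k φ ∘ₗ Linear.rightComp k (LinCorr.of k (Irr T))
      ((Free.embedding k FinCorr).map (X := X) (Y := Y) U) =
        inclusionForm k (corrAct (oppCorr U) φ) from LinearMap.congr_fun h α
  refine Finsupp.lhom_ext fun (Q : Set (X × Irr T)) r => ?_
  refine Eq.trans ?_ (inclusionForm_single k _ Q r).symm
  refine (congrArg (inclusionForm k φ)
    (Free.single_comp_single k FinCorr (X := FinCorr.mk (Irr T)) Q U r 1)).trans ?_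
  refine (inclusionForm_single k φ _ _).trans ?_
  rw [mul_one]
  congr 2
  exact corrAct_oppCorr_comp Q U φ

/-- An element of `⟨γ_T⟩(X)` killed by all the correspondences from `X` to `E` is zero. -/
lemma gammaMap_eq_zero_of_comp {X : FinCorr.{u}} (α : LinCorr.of k (Irr T) ⟶ Free.of k X)
    (h : ∀ ψ : Free.of k X ⟶ LinCorr.of k (Irr T), gammaMap k T _ (α ≫ ψ) = 0) :
    gammaMap k T (Free.of k X) α = 0 := by
  rw [gammaMap_eq_zero_iff]
  intro φ
  -- With this U, (U^op ι)(x) is the join of all irreducibles below φ(x), which is φ(x).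
  let U : Set (Irr T × X) := {p | p.1.1 ≤ φ p.2}
  have hU : corrAct (oppCorr U) (Subtype.val : Irr T → T) = φ := by
    funext x
    refine le_antisymm ((corrAct_le_iff _ _ _ _).2 fun e he => he) ?_
    obtain ⟨s, hs, hirr⟩ := exists_supIrred_decomposition (φ x)
    conv_lhs => rw [← hs]
    refine Finset.sup_le fun b hb => ?_
    refine (corrAct_le_iff (oppCorr U) (Subtype.val : Irr T → T) x _).1 le_rfl ⟨b, hirr hb⟩ ?_
    exact (Finset.le_sup (f := id) hb).trans_eq hs
  have := (gammaMap_eq_zero_iff k (X := FinCorr.mk (Irr T)) _).1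
    (h ((Free.embedding k FinCorr).map (X := X) (Y := FinCorr.mk (Irr T)) U)) Subtype.val
  rw [inclusionForm_comp_single] at this
  rwa [← hU]

end Pairing

/-! ### The algebra of permuted orders and the action of relations on f_R. -/

section PermutedOrders

variable {E : Type u}

/-- The composite of two relations. -/
def compRel (A B : Set (E × E)) : Set (E × E) := {p | ∃ y, (p.1, y) ∈ A ∧ (y, p.2) ∈ B}

/-- The relation consisting of the pairs `(x, τ x)`. -/
def permRel (τ : Equiv.Perm E) : Set (E × E) := {p | τ p.1 = p.2}

/-- Going down along π from π(e) returns to e after finitely many steps, so e ≤ π(e) ≤ e. -/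
lemma OrderRel.perm_eq_one [Finite E] (R : OrderRel E) {π : Equiv.Perm E}
    (h : ∀ e, (π e, e) ∈ R.1) : π = 1 := by
  have hpow (n : ℕ) (x : E) : ((π ^ n) x, x) ∈ R.1 := by
    induction n with
    | zero => exact R.2.1 x
    | succ n ih =>
      rw [pow_succ', Equiv.Perm.mul_apply]
      exact R.2.2.2 _ _ _ (h _) ih
  ext e
  refine R.2.2.1 _ _ (h e) ?_
  have h1 := hpow (orderOf π - 1) (π e)
  rwa [← Equiv.Perm.mul_apply, ← pow_succ, Nat.sub_add_cancel (orderOf_pos π),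
    pow_orderOf_eq_one] at h1

lemma transClosure_subset_iff (S : Set (E × E)) (V : OrderRel E) :
    transClosure S ⊆ V.1 ↔ S ⊆ V.1 := by
  refine ⟨fun h p hp => h (Relation.TransGen.single hp), fun h => ?_⟩
  rintro ⟨x, y⟩ hxy
  change Relation.TransGen _ x y at hxy
  induction hxy with
  | single hp => exact h hp
  | tail _ hp ih => exact V.2.2.2 _ _ _ ih (h hp)

variable [Finite E]

/-- By Hall's theorem, a relation either contains a permutation or is inessential. -/
lemma exists_perm_or_isInessential (Q : Set (E × E)) :
    (∃ τ : Equiv.Perm E, ∀ e, (τ.symm e, e) ∈ Q) ∨ IsInessential Q := by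
  classical
  let : Fintype E := Fintype.ofFinite E
  by_cases h : ∀ A : Finset E, A.card ≤ (Finset.univ.filter fun b => ∃ a ∈ A, (b, a) ∈ Q).card
  · left
    obtain ⟨f, hf, hQ⟩ :=
      (Fintype.all_card_le_filter_rel_iff_exists_injective fun a b => (b, a) ∈ Q).1 h
    exact ⟨(Equiv.ofBijective f (Finite.injective_iff_bijective.1 hf)).symm, hQ⟩
  · right
    push Not at h
    obtain ⟨A, hA⟩ := h
    set N : Finset E := Finset.univ.filter fun b => ∃ a ∈ A, (b, a) ∈ Q with hN
    -- Pairs of `Q` with second entry in `A` factor through their first entries, which lie in `N`;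
    -- the others factor through their second entry. The failure of Hall's condition gives |N| <
    -- |A|.
    refine ⟨FinCorr.mk (N ⊕ {a // a ∉ A}),
      ({p | Sum.elim (fun b => p.2 ∈ A ∧ (b.1, p.2) ∈ Q) (fun a => a.1 = p.2) p.1} :
        Set ((N ⊕ {a // a ∉ A}) × E)),
      ({p | Sum.elim (fun b => p.1 = b.1) (fun a => (p.1, a.1) ∈ Q) p.2} :
        Set (E × (N ⊕ {a // a ∉ A}))), ?_, ?_⟩
    · have h1 : Nat.card (N ⊕ {a // a ∉ A}) = N.card + (Fintype.card E - A.card) := by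
        rw [Nat.card_eq_fintype_card, Fintype.card_sum, Fintype.card_coe,
          Fintype.card_subtype_compl, Fintype.card_coe]
      change Nat.card (N ⊕ {a // a ∉ A}) < Nat.card E
      have h2 : A.card ≤ Fintype.card E := Finset.card_le_univ A
      rw [h1, Nat.card_eq_fintype_card]
      omega
    · refine Set.ext (α := E × E) ?_
      rintro ⟨x, e⟩
      constructor
      · rintro ⟨b | a, h1, h2⟩
        · obtain ⟨_, h2⟩ := h2
          change x = b.1 at h1
          rwa [h1]
        · change a.1 = e at h2
          change (x, a.1) ∈ Q at h1
          rwa [← h2]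
      · intro hx
        by_cases he : e ∈ A
        · exact ⟨Sum.inl ⟨x, by simpa [hN] using ⟨e, he, hx⟩⟩, rfl, he, hx⟩
        · exact ⟨Sum.inr ⟨e, he⟩, hx, rfl⟩

/-- For a preorder, equivalent points a and b are interchangeable, so S factors through E without b.
-/
lemma isInessential_of_not_antisymm {S : Set (E × E)} (hrefl : ∀ e, (e, e) ∈ S)
    (htrans : ∀ a b c, (a, b) ∈ S → (b, c) ∈ S → (a, c) ∈ S) {a b : E} (hab : (a, b) ∈ S)
    (hba : (b, a) ∈ S) (hne : a ≠ b) : IsInessential S := by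
  classical
  let : Fintype E := Fintype.ofFinite E
  refine ⟨FinCorr.mk {x // x ≠ b}, ({p | (p.1.1, p.2) ∈ S} : Set ({x // x ≠ b} × E)),
    ({p | (p.1, p.2.1) ∈ S} : Set (E × {x // x ≠ b})), ?_, ?_⟩
  · change Nat.card {x // x ≠ b} < Nat.card E
    rw [Nat.card_eq_fintype_card, Nat.card_eq_fintype_card]
    exact Fintype.card_subtype_lt (x := b) (by simp)
  · refine Set.ext (α := E × E) ?_
    rintro ⟨x, e⟩
    constructor
    · rintro ⟨y, h1, h2⟩
      exact htrans _ _ _ h1 h2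
    · intro h
      by_cases he : e = b
      · subst he
        exact ⟨⟨a, hne⟩, htrans _ _ _ h hba, hab⟩
      · exact ⟨⟨e, he⟩, h, hrefl e⟩

variable (k : Type v) [CommRing k]

lemma RelAlg.rel_mul_rel (A B : Set (E × E)) :
    RelAlg.rel k A * RelAlg.rel k B = RelAlg.rel k (compRel A B) :=
  ((Free.embedding k FinCorr).map_comp (X := FinCorr.mk E) (Y := FinCorr.mk E)
    (Z := FinCorr.mk E) B A).symm

namespace PermOrderAlg

lemma proj_surjective : Function.Surjective (proj k E) := RingCon.mk'_surjective _

lemma proj_eq_zero_iff (a : RelAlg k E) :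
    proj k E a = 0 ↔ a ∈ inessentialIdeal k E ⊔ closureIdeal k E :=
  RingCon.eq _

lemma proj_rel_mul (A B : Set (E × E)) :
    proj k E (RelAlg.rel k A) * proj k E (RelAlg.rel k B) =
      proj k E (RelAlg.rel k (compRel A B)) := by
  rw [← map_mul, RelAlg.rel_mul_rel]

lemma proj_rel_of_isInessential {Q : Set (E × E)} (h : IsInessential Q) :
    proj k E (RelAlg.rel k Q) = 0 :=
  (proj_eq_zero_iff k _).2
    (TwoSidedIdeal.mem_sup_left (TwoSidedIdeal.subset_span ⟨Q, h, rfl⟩))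

lemma proj_rel_transClosure {S : Set (E × E)} (h : ∀ e, (e, e) ∈ S) :
    proj k E (RelAlg.rel k (transClosure S)) = proj k E (RelAlg.rel k S) := by
  refine ((RingCon.eq _).2 ((TwoSidedIdeal.rel_iff _ _ _).2 ?_)).symm
  exact TwoSidedIdeal.mem_sup_right (TwoSidedIdeal.subset_span ⟨S, h, rfl⟩)

/-- The class of a reflexive relation is the class of the order it generates, if any, and it is
zero otherwise. -/
lemma proj_rel_reflexive {S : Set (E × E)} (h : ∀ e, (e, e) ∈ S) :
    (∃ U : OrderRel E, proj k E (RelAlg.rel k S) = proj k E (RelAlg.rel k U.1) ∧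
      ∀ V : OrderRel E, U ≤ V ↔ S ⊆ V.1) ∨
    (proj k E (RelAlg.rel k S) = 0 ∧ ∀ V : OrderRel E, ¬ S ⊆ V.1) := by
  have hr (e : E) : (e, e) ∈ transClosure S := Relation.TransGen.single (h e)
  have ht (a b c : E) (h1 : (a, b) ∈ transClosure S) (h2 : (b, c) ∈ transClosure S) :
      (a, c) ∈ transClosure S := Relation.TransGen.trans h1 h2
  rw [← proj_rel_transClosure k h]
  by_cases ha : ∀ a b, (a, b) ∈ transClosure S → (b, a) ∈ transClosure S → a = b
  · exact Or.inl ⟨⟨transClosure S, hr, ha, ht⟩, rfl, fun V => transClosure_subset_iff S V⟩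
  · push Not at ha
    obtain ⟨a, b, hab, hba, hne⟩ := ha
    refine Or.inr ⟨proj_rel_of_isInessential k (isInessential_of_not_antisymm hr ht hab hba hne),
      fun V hV => hne ?_⟩
    rw [← transClosure_subset_iff] at hV
    exact V.2.2.1 a b (hV hab) (hV hba)

open Classical in
/-- Möbius inversion: an order is the sum of the idempotents of the orders containing it. -/
lemma proj_rel_eq_sum_fundIdempotent [Fintype (OrderRel E)] (R : OrderRel E) :
    proj k E (RelAlg.rel k R.1) = ∑ S : OrderRel E, if R ≤ S then fundIdempotent k S else 0 := by
  obtain rfl : ‹Fintype (OrderRel E)› = Fintype.ofFinite _ := Subsingleton.elim _ _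
  let : Fintype (OrderRel E) := Fintype.ofFinite _
  let : LocallyFiniteOrder (OrderRel E) := Fintype.toLocallyFiniteOrder
  have h1 (S : OrderRel E) : (if R ≤ S then fundIdempotent k S else 0) =
      ∑ U : OrderRel E, (if S ∈ Finset.Icc R U then IncidenceAlgebra.mu k S U else 0) •
        proj k E (RelAlg.rel k U.1) := by
    split_ifs with hR
    · refine Finset.sum_congr rfl fun U _ => ?_
      by_cases hU : S ≤ U
      · rw [if_pos hU, if_pos (Finset.mem_Icc.2 ⟨hR, hU⟩)]
      · rw [if_neg hU, if_neg fun h => hU (Finset.mem_Icc.1 h).2, zero_smul]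
    · refine (Finset.sum_eq_zero fun U _ => ?_).symm
      rw [if_neg fun h => hR (Finset.mem_Icc.1 h).1, zero_smul]
  -- After the exchange, the coefficient of U is the sum of μ(S, U) over the interval [R, U], which
  -- is 1 for U = R and 0 otherwise.
  rw [Finset.sum_congr rfl fun S _ => h1 S, Finset.sum_comm]
  simp only [← Finset.sum_smul, Finset.sum_ite_mem, Finset.univ_inter,
    IncidenceAlgebra.sum_Icc_mu_left, ite_smul, one_smul, zero_smul]
  rw [Finset.sum_ite_eq, if_pos (Finset.mem_univ R)]

/-- Every order U occurring in f_R contains S, whence SU = U by reflexivity of S and transitivity of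
U. -/
lemma proj_rel_mul_fundIdempotent_of_subset {S : Set (E × E)} (h : ∀ e, (e, e) ∈ S)
    (R : OrderRel E) (hS : S ⊆ R.1) :
    proj k E (RelAlg.rel k S) * fundIdempotent k R = fundIdempotent k R := by
  rw [fundIdempotent, Finset.mul_sum]
  refine Finset.sum_congr rfl fun U _ => ?_
  split_ifs with hU
  · rw [mul_smul_comm, proj_rel_mul]
    congr 3
    ext ⟨x, y⟩
    exact ⟨fun ⟨z, h1, h2⟩ => U.2.2.2 _ _ _ (hU (hS h1)) h2, fun h1 => ⟨x, h x, h1⟩⟩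
  · exact mul_zero _

/-- The class of SR has two expansions: the sum of f_V over orders V containing R and S, and the sum
of S f_V over V containing R. By induction on larger orders, all terms with V ≠ R agree, leaving S
f_R = 0. -/
lemma proj_rel_mul_fundIdempotent_of_not_subset {S : Set (E × E)} (h : ∀ e, (e, e) ∈ S)
    (R : OrderRel E) (hS : ¬ S ⊆ R.1) :
    proj k E (RelAlg.rel k S) * fundIdempotent k R = 0 := by
  classical
  let : Fintype (OrderRel E) := Fintype.ofFinite _
  induction R using WellFoundedGT.induction with
  | ind R ih =>
  have hsub (V : OrderRel E) : compRel S R.1 ⊆ V.1 ↔ R ≤ V ∧ S ⊆ V.1 := by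
    refine ⟨fun H => ⟨fun p hp => H ⟨p.1, h _, hp⟩, fun p hp => H ⟨p.2, hp, R.2.1 _⟩⟩, ?_⟩
    rintro ⟨h1, h2⟩ p ⟨y, hy, hy'⟩
    exact V.2.2.2 _ _ _ (h2 hy) (h1 hy')
  have h1 : proj k E (RelAlg.rel k (compRel S R.1)) =
      ∑ V : OrderRel E, if R ≤ V ∧ S ⊆ V.1 then fundIdempotent k V else 0 := by
    rcases proj_rel_reflexive k (S := compRel S R.1) fun e => ⟨e, h e, R.2.1 e⟩ with
      ⟨U, hU, hU'⟩ | ⟨h0, h0'⟩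
    · rw [hU, proj_rel_eq_sum_fundIdempotent]
      simp only [hU', hsub]
    · rw [h0, Finset.sum_eq_zero]
      intro V _
      rw [if_neg fun hV => h0' V ((hsub V).2 hV)]
  have h2 : proj k E (RelAlg.rel k (compRel S R.1)) =
      ∑ V : OrderRel E, if R ≤ V then proj k E (RelAlg.rel k S) * fundIdempotent k V else 0 := by
    rw [← proj_rel_mul, proj_rel_eq_sum_fundIdempotent k R, Finset.mul_sum]
    simp only [mul_ite, mul_zero]
  rw [h1, eq_comm, ← sub_eq_zero, ← Finset.sum_sub_distrib,
    Finset.sum_eq_single_of_mem R (Finset.mem_univ R)] at h2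
  · rwa [if_pos le_rfl, if_neg fun h => hS h.2, sub_zero] at h2
  · intro V _ hne
    by_cases hV : R ≤ V
    · by_cases hSV : S ⊆ V.1
      · rw [if_pos hV, if_pos ⟨hV, hSV⟩, proj_rel_mul_fundIdempotent_of_subset k h V hSV,
          sub_self]
      · rw [if_pos hV, if_neg fun h => hSV h.2,
          ih V (lt_of_le_of_ne hV (Ne.symm hne)) hSV, sub_self]
    · rw [if_neg hV, if_neg fun h => hV h.1, sub_self]

open Classical in
/-- The action of a relation on `f_R`, where at most one summand is nonzero. -/
lemma proj_rel_mul_fundIdempotent [Fintype (Equiv.Perm E)] (Q : Set (E × E)) (R : OrderRel E) :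
    proj k E (RelAlg.rel k Q) * fundIdempotent k R =
      ∑ τ : Equiv.Perm E,
        if (∀ x e, (x, e) ∈ Q → (τ x, e) ∈ R.1) ∧ ∀ e, (τ.symm e, e) ∈ Q then
          proj k E (RelAlg.rel k (permRel τ)) * fundIdempotent k R else 0 := by
  -- Relabelling by τ splits off a permutation; the remaining factor is reflexive exactly when
  -- (τ⁻¹e, e) ∈ Q for all e.
  have hfac (τ : Equiv.Perm E) : proj k E (RelAlg.rel k Q) =
      proj k E (RelAlg.rel k (permRel τ)) *
        proj k E (RelAlg.rel k {p | (τ.symm p.1, p.2) ∈ Q}) := by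
    rw [proj_rel_mul]
    congr 2
    ext ⟨x, e⟩
    refine ⟨fun h => ⟨τ x, rfl, by simpa using h⟩, ?_⟩
    rintro ⟨y, hy, h⟩
    change τ x = y at hy
    subst hy
    simpa using h
  by_cases hτ : ∃ τ : Equiv.Perm E,
      (∀ x e, (x, e) ∈ Q → (τ x, e) ∈ R.1) ∧ ∀ e, (τ.symm e, e) ∈ Q
  · obtain ⟨τ, h1, h2⟩ := hτ
    rw [Finset.sum_eq_single_of_mem τ (Finset.mem_univ τ), if_pos ⟨h1, h2⟩, hfac τ, mul_assoc,
      proj_rel_mul_fundIdempotent_of_subset k h2]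
    · rintro ⟨x, e⟩ hx
      simpa using h1 _ _ hx
    · intro τ' _ hne
      refine if_neg fun ⟨h3, _⟩ => hne ?_
      have := R.perm_eq_one (π := τ' * τ⁻¹) fun e => h3 _ _ (h2 e)
      rwa [mul_inv_eq_one] at this
  · rw [Finset.sum_eq_zero fun τ _ => if_neg fun h => hτ ⟨τ, h⟩]
    rcases exists_perm_or_isInessential Q with ⟨τ, h⟩ | h
    · rw [hfac τ, mul_assoc, proj_rel_mul_fundIdempotent_of_not_subset k h, mul_zero]
      exact fun hsub => hτ ⟨τ, fun x e hx => hsub (by simpa using hx), h⟩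
    · rw [proj_rel_of_isInessential k h, zero_mul]

end PermOrderAlg

end PermutedOrders

/-! ### Comparison of the annihilators of γ_T and f_R on E. -/

section Annihilators

variable {T : Type u} [Lattice T]

section

variable [BoundedOrder T]

lemma exists_eq_of_corrAct_eq {X Y : Type u} [Finite X] {Q : Set (Y × X)} {φ : X → T} {y : Y}
    {t : T} (ht : SupIrred t) (h : corrAct Q φ y = t) : ∃ x, (y, x) ∈ Q ∧ φ x = t := by
  obtain ⟨x, hx, hxt⟩ := ht.finset_sup_eq h
  exact ⟨x, by simpa using hx, hxt⟩

lemma corrAct_eq_self_iff {X : Type u} [Finite X] {S : Set (X × X)} (hS : ∀ x, (x, x) ∈ S)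
    (φ : X → T) : corrAct S φ = φ ↔ ∀ x y, (x, y) ∈ S → φ y ≤ φ x := by
  constructor
  · intro h x y hxy
    exact (corrAct_le_iff S φ x _).1 (congrFun h x).le y hxy
  · exact fun h => funext fun x => le_antisymm ((corrAct_le_iff S φ x _).2 (h x))
      ((corrAct_le_iff S φ x _).1 le_rfl x (hS x))

end

variable [Finite T]

lemma exists_perm_of_irr_subset_range {φ : Irr T → T} (h : ∀ e : Irr T, ∃ x, φ x = e.1) :
    ∃ τ : Equiv.Perm (Irr T), φ = fun x => (τ x).1 := by
  choose g hg using h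
  have hinj : Function.Injective g := fun a b hab => Subtype.ext (by rw [← hg a, ← hg b, hab])
  refine ⟨(Equiv.ofBijective g (Finite.injective_iff_bijective.1 hinj)).symm, funext fun x => ?_⟩
  rw [← hg]
  exact congrArg φ (Equiv.apply_symm_apply (Equiv.ofBijective g _) x).symm

variable [BoundedOrder T]

/-- An irreducible join is attained, so both Sφ and φ hit every irreducible and are permutations τ
and σ of E. Reflexivity gives σ ≤ τ pointwise, and a permutation that moves everything down is
trivial. -/
lemma corrAct_eq_self_of_irr_subset_range {S : Set (Irr T × Irr T)} (hS : ∀ x, (x, x) ∈ S)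
    {φ : Irr T → T} (h : ∀ e : Irr T, ∃ x, corrAct S φ x = e.1) : corrAct S φ = φ := by
  obtain ⟨τ, hτ⟩ := exists_perm_of_irr_subset_range h
  obtain ⟨σ, hσ⟩ := exists_perm_of_irr_subset_range (φ := φ) fun e => by
    obtain ⟨x, hx⟩ := h e
    obtain ⟨y, _, hy⟩ := exists_eq_of_corrAct_eq e.2 hx
    exact ⟨y, hy⟩
  have hle (x : Irr T) : (σ x).1 ≤ (τ x).1 := by
    have := (corrAct_le_iff S φ x _).1 le_rfl x (hS x)
    rwa [hτ, hσ] at this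
  have := (irrOrder T).perm_eq_one (π := σ * τ⁻¹) fun e => by
    change (σ (τ⁻¹ e)).1 ≤ e.1
    simpa using hle (τ⁻¹ e)
  rw [hτ, hσ, mul_inv_eq_one.1 this]

variable (k : Type v) [CommRing k]

lemma inclusionForm_eq_zero {X : FinCorr.{u}} {φ : X → T}
    (h : ¬ ∀ e : Irr T, ∃ x, φ x = e.1) (α : LinCorr.of k (Irr T) ⟶ Free.of k X) :
    inclusionForm k φ α = 0 := by
  suffices hz : inclusionForm k φ = 0 from LinearMap.congr_fun hz α
  refine Finsupp.lhom_ext fun (Q : Set (X × Irr T)) r => ?_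
  refine (inclusionForm_single k φ Q r).trans (if_neg fun hQ => h fun e => ?_)
  obtain ⟨x, _, hx⟩ := exists_eq_of_corrAct_eq e.2 (congrFun hQ e)
  exact ⟨x, hx⟩

lemma inclusionForm_comp_rel (φ : Irr T → T) (δ : RelAlg k (Irr T))
    (Q : Set (Irr T × Irr T)) :
    inclusionForm (X := FinCorr.mk (Irr T)) k φ (δ.asHom ≫ (RelAlg.rel k Q).asHom) =
      inclusionForm (X := FinCorr.mk (Irr T)) k (corrAct (oppCorr Q) φ) δ.asHom :=
  inclusionForm_comp_single k (X := FinCorr.mk (Irr T)) (Y := FinCorr.mk (Irr T)) φ δ.asHom Q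

lemma gammaMap_comp {X Y : LinCorr.{u, v} k} (α : LinCorr.of k (Irr T) ⟶ X) (β : X ⟶ Y) :
    gammaMap k T Y (α ≫ β) = ((latticeFunctor k Tᵒᵈ).map β).hom (gammaMap k T X α) :=
  congrArg (fun f => f.hom (gammaElem k T)) ((latticeFunctor k Tᵒᵈ).map_comp α β)

variable (T) in
/-- The annihilator of the module `⟨γ_T⟩(E)`. -/
def gammaAnnihilator : TwoSidedIdeal (RelAlg k (Irr T)) :=
  -- Quantifying over δ is what gives closure under right multiplication.
  TwoSidedIdeal.mk' {b | ∀ δ : RelAlg k (Irr T), gammaMap k T _ (δ.asHom ≫ b.asHom) = 0}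
    (fun δ => (congrArg _ Limits.comp_zero).trans (map_zero _))
    (fun {x y} hx hy δ => (congrArg (gammaMap k T _) (Preadditive.comp_add _ _ _ _ _ _)).trans
      ((map_add _ _ _).trans (by rw [hx, hy, add_zero])))
    (fun {x} hx δ => (congrArg (gammaMap k T _) (Preadditive.comp_neg _ _)).trans
      ((map_neg _ _).trans (by rw [hx, neg_zero])))
    (fun {x y} hy δ => (congrArg (gammaMap k T _) (Category.assoc _ _ _).symm).trans
      ((gammaMap_comp k _ _).trans (by rw [hy]; exact map_zero _)))
    (fun {x y} hx δ => (congrArg (gammaMap k T _) (Category.assoc _ _ _).symm).trans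
      (hx (End.of (δ.asHom ≫ y.asHom))))

lemma mem_gammaAnnihilator {b : RelAlg k (Irr T)} :
    b ∈ gammaAnnihilator T k ↔
      ∀ δ : RelAlg k (Irr T), gammaMap k T _ (δ.asHom ≫ b.asHom) = 0 :=
  TwoSidedIdeal.mem_mk' _ _ _ _ _ _ _

/-- If the action of a relation factoring through Y hit all irreducibles, their preimages would
inject E into Y; when some irreducible is missed, all forms vanish by `inclusionForm_eq_zero`. -/
lemma inessentialIdeal_le_gammaAnnihilator :
    inessentialIdeal k (Irr T) ≤ gammaAnnihilator T k := by
  refine TwoSidedIdeal.span_le.2 ?_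
  rintro _ ⟨Q, ⟨Y, S, R, hcard, rfl⟩, rfl⟩
  refine (mem_gammaAnnihilator k).2 fun δ => ?_
  refine (gammaMap_eq_zero_iff k (X := FinCorr.mk (Irr T)) _).2 fun φ => ?_
  refine (inclusionForm_comp_rel k φ δ _).trans (inclusionForm_eq_zero k (fun h => ?_) _)
  have hc : corrAct (oppCorr (S ≫ R)) φ = corrAct (oppCorr S) (corrAct (oppCorr R) φ) :=
    corrAct_oppCorr_comp S R φ
  have hY (e : Irr T) : ∃ y, corrAct (oppCorr R) φ y = e.1 := by
    obtain ⟨x, hx⟩ := h e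
    rw [hc] at hx
    obtain ⟨y, _, hy⟩ := exists_eq_of_corrAct_eq e.2 hx
    exact ⟨y, hy⟩
  choose g hg using hY
  have hinj : Function.Injective g := fun a b hab => Subtype.ext (by rw [← hg a, ← hg b, hab])
  exact absurd hcard (not_lt.2 (Nat.card_le_card_of_injective g hinj))

/-- S and its transitive closure fix the same maps φ. When φ is not fixed, neither image contains
all irreducibles and both forms are zero. -/
lemma closureIdeal_le_gammaAnnihilator :
    closureIdeal k (Irr T) ≤ gammaAnnihilator T k := by
  refine TwoSidedIdeal.span_le.2 ?_
  rintro _ ⟨S, hS, rfl⟩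
  refine (mem_gammaAnnihilator k).2 fun δ => ?_
  refine (gammaMap_eq_zero_iff k (X := FinCorr.mk (Irr T)) _).2 fun φ => ?_
  have hS' (x : Irr T) : (x, x) ∈ transClosure S := Relation.TransGen.single (hS x)
  have hiff : corrAct (oppCorr S) φ = φ ↔ corrAct (oppCorr (transClosure S)) φ = φ := by
    rw [corrAct_eq_self_iff (S := oppCorr S) hS,
      corrAct_eq_self_iff (S := oppCorr (transClosure S)) hS']
    refine ⟨fun h x y hxy => ?_, fun h x y hxy => h x y (Relation.TransGen.single hxy)⟩
    change Relation.TransGen _ y x at hxy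
    induction hxy with
    | single hp => exact h _ _ hp
    | tail _ hp ih => exact ih.trans (h _ _ hp)
  have key : inclusionForm (X := FinCorr.mk (Irr T)) k (corrAct (oppCorr S) φ) δ.asHom =
      inclusionForm (X := FinCorr.mk (Irr T)) k (corrAct (oppCorr (transClosure S)) φ)
        δ.asHom := by
    by_cases h1 : ∀ e : Irr T, ∃ x, corrAct (oppCorr S) φ x = e.1
    · have h := corrAct_eq_self_of_irr_subset_range (S := oppCorr S) hS h1
      rw [h, hiff.1 h]
    by_cases h2 : ∀ e : Irr T, ∃ x, corrAct (oppCorr (transClosure S)) φ x = e.1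
    · have h := corrAct_eq_self_of_irr_subset_range (S := oppCorr (transClosure S)) hS' h2
      rw [h, hiff.2 h]
    · rw [inclusionForm_eq_zero k h1, inclusionForm_eq_zero k h2]
  refine (congrArg (inclusionForm k φ) (Preadditive.comp_sub _ _ _)).trans ?_
  refine (map_sub _ _ _).trans (sub_eq_zero.2 ?_)
  rw [inclusionForm_comp_rel, inclusionForm_comp_rel, key]

lemma gammaMap_eq_zero_of_mem {b : RelAlg k (Irr T)} (h : PermOrderAlg.proj k (Irr T) b = 0) :
    gammaMap k T _ b.asHom = 0 := by
  rw [PermOrderAlg.proj_eq_zero_iff] at h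
  have hle := sup_le (inessentialIdeal_le_gammaAnnihilator (T := T) k)
    (closureIdeal_le_gammaAnnihilator k)
  have := (mem_gammaAnnihilator k).1 (hle h) 1
  rwa [show (1 : RelAlg k (Irr T)).asHom ≫ b.asHom = b.asHom from Category.id_comp _] at this

lemma corrAct_order_eq_inclusion_iff (S : OrderRel (Irr T)) (φ : Irr T → T) :
    corrAct (oppCorr S.1) φ = Subtype.val ↔ S ≤ irrOrder T ∧ φ = Subtype.val := by
  have hS : ∀ x, (x, x) ∈ oppCorr S.1 := S.2.1
  have hiff : corrAct (oppCorr S.1) (Subtype.val : Irr T → T) = Subtype.val ↔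
      S ≤ irrOrder T := by
    rw [corrAct_eq_self_iff hS]
    exact ⟨fun h p hp => h p.2 p.1 hp, fun h x y hxy => h hxy⟩
  constructor
  · intro h
    have hφ := corrAct_eq_self_of_irr_subset_range hS (φ := φ) fun e => ⟨e, congrFun h e⟩
    rw [h] at hφ
    exact ⟨hiff.1 (by rwa [← hφ] at h), hφ.symm⟩
  · rintro ⟨h, rfl⟩
    exact hiff.2 h

open Classical in
lemma exists_lift_fundIdempotent : ∃ b : RelAlg k (Irr T),
    PermOrderAlg.proj k (Irr T) b = fundIdempotent k (irrOrder T) ∧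
      gammaMap k T _ b.asHom = gammaElem k T := by
  let : Fintype (OrderRel (Irr T)) := Fintype.ofFinite _
  let : LocallyFiniteOrder (OrderRel (Irr T)) := Fintype.toLocallyFiniteOrder
  let b : RelAlg k (Irr T) := ∑ S : OrderRel (Irr T), if irrOrder T ≤ S then
    IncidenceAlgebra.mu k (irrOrder T) S • RelAlg.rel k S.1 else 0
  refine ⟨b, ?_, ?_⟩
  · refine (map_sum (PermOrderAlg.proj k (Irr T)) _ _).trans ?_
    rw [fundIdempotent]
    refine Finset.sum_congr rfl fun S _ => ?_
    split_ifs
    · rfl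
    · exact (PermOrderAlg.proj k (Irr T)).map_zero
  · have hb (φ : Irr T → T) : inclusionForm (X := FinCorr.mk (Irr T)) k φ b.asHom =
        if φ = Subtype.val then 1 else 0 := by
      have hterm (S : OrderRel (Irr T)) :
          inclusionForm (X := FinCorr.mk (Irr T)) k φ (RelAlg.rel k S.1).asHom =
            if S ≤ irrOrder T ∧ φ = Subtype.val then 1 else 0 :=
        (inclusionForm_single (X := FinCorr.mk (Irr T)) k φ S.1 1).trans
          (if_congr (corrAct_order_eq_inclusion_iff S φ) rfl rfl)
      refine (map_sum (inclusionForm (X := FinCorr.mk (Irr T)) k φ) _ _).trans ?_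
      -- The sum runs over S ⊇ R while the form is nonzero only for S ⊆ R, so only S = R survives,
      -- with coefficient μ(R, R) = 1.
      rw [Finset.sum_eq_single_of_mem (irrOrder T) (Finset.mem_univ _)]
      · rw [if_pos le_rfl, IncidenceAlgebra.mu_self, one_smul]
        refine (hterm _).trans ?_
        simp
      · intro S _ hne
        split_ifs with hS
        · refine (map_smul _ _ _).trans ?_
          refine (congrArg _ (hterm S)).trans ?_
          rw [if_neg fun h => hne (le_antisymm h.1 hS), smul_zero]
        · exact map_zero _
    refine sub_eq_zero.1 (eq_zero_of_latticePairing_eq_zero k fun φ => ?_)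
    refine (map_sub (latticePairing k φ) _ _).trans (sub_eq_zero.2 ?_)
    refine (latticePairing_gammaMap k (X := FinCorr.mk (Irr T)) φ _).trans ?_
    exact (hb φ).trans (latticePairing_gammaElem k φ).symm

lemma gammaMap_eq_zero_of_mul_fundIdempotent {a : RelAlg k (Irr T)}
    (h : PermOrderAlg.proj k (Irr T) a * fundIdempotent k (irrOrder T) = 0) :
    gammaMap k T _ a.asHom = 0 := by
  obtain ⟨b, hb, hγ⟩ := exists_lift_fundIdempotent (T := T) k
  rw [← hb, ← map_mul] at h
  have := gammaMap_eq_zero_of_mem k h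
  refine Eq.trans ?_ this
  refine Eq.trans ?_ (gammaMap_comp k b.asHom a.asHom).symm
  rw [hγ]
  rfl

/-- This matches the condition selecting τ in `proj_rel_mul_fundIdempotent`: the inequality ≤ gives
the first half, attainment of irreducible joins the second. -/
lemma corrAct_eq_inclusion_iff (Q : Set (Irr T × Irr T)) (τ : Equiv.Perm (Irr T)) :
    (corrAct (oppCorr Q) (fun x => (τ x).1) = Subtype.val) ↔
      (∀ x e, (x, e) ∈ Q → (τ x, e) ∈ (irrOrder T).1) ∧ ∀ e, (τ.symm e, e) ∈ Q := by
  constructor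
  · refine fun h => ⟨fun x e hx => ?_, fun e => ?_⟩
    · exact (corrAct_le_iff _ _ _ _).1 (congrFun h e).le x hx
    · obtain ⟨x, hx, hxe⟩ := exists_eq_of_corrAct_eq e.2 (congrFun h e)
      have : τ x = e := Subtype.ext hxe
      rw [← this, Equiv.symm_apply_apply, this]
      exact hx
  · rintro ⟨h1, h2⟩
    funext e
    refine le_antisymm ((corrAct_le_iff _ _ _ _).2 fun x hx => h1 x e hx) ?_
    have := (corrAct_le_iff (oppCorr Q) (fun x => (τ x).1) e _).1 le_rfl (τ.symm e) (h2 e)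
    rwa [Equiv.apply_symm_apply] at this

lemma proj_mul_fundIdempotent_eq_sum [Fintype (Equiv.Perm (Irr T))] (a : RelAlg k (Irr T)) :
    PermOrderAlg.proj k (Irr T) a * fundIdempotent k (irrOrder T) =
      ∑ τ : Equiv.Perm (Irr T),
        inclusionForm (X := FinCorr.mk (Irr T)) k (fun x => (τ x).1) a.asHom •
          (PermOrderAlg.proj k (Irr T) (RelAlg.rel k (permRel τ)) *
            fundIdempotent k (irrOrder T)) := by
  classical
  let L : RelAlg k (Irr T) →ₗ[k] PermOrderAlg k (Irr T) :=
    { toFun := fun a => PermOrderAlg.proj k (Irr T) a * fundIdempotent k (irrOrder T)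
      map_add' := fun a b => (congrArg (· * _) ((PermOrderAlg.proj k (Irr T)).map_add a b)).trans
        (add_mul _ _ _)
      map_smul' := fun c a => smul_mul_assoc c (PermOrderAlg.proj k (Irr T) a) _ }
  let M : RelAlg k (Irr T) →ₗ[k] PermOrderAlg k (Irr T) := ∑ τ : Equiv.Perm (Irr T),
    (inclusionForm (X := FinCorr.mk (Irr T)) k (fun x => (τ x).1)).smulRight
      (PermOrderAlg.proj k (Irr T) (RelAlg.rel k (permRel τ)) * fundIdempotent k (irrOrder T))
  suffices h : L = M by
    refine (LinearMap.congr_fun h a).trans ?_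
    simp only [M, LinearMap.sum_apply, LinearMap.smulRight_apply]
  refine Finsupp.lhom_ext' fun (Q : Set (Irr T × Irr T)) => LinearMap.ext_ring ?_
  change PermOrderAlg.proj k (Irr T) (RelAlg.rel k Q) * fundIdempotent k (irrOrder T) =
    M (RelAlg.rel k Q)
  rw [PermOrderAlg.proj_rel_mul_fundIdempotent]
  simp only [M, LinearMap.sum_apply, LinearMap.smulRight_apply]
  refine Finset.sum_congr rfl fun τ _ => ?_
  refine Eq.trans ?_ (congrArg (· • _)
    (inclusionForm_single (X := FinCorr.mk (Irr T)) k (fun x => (τ x).1) Q 1)).symm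
  rw [ite_smul, one_smul, zero_smul]
  exact if_congr (corrAct_eq_inclusion_iff Q τ).symm rfl rfl

lemma gammaMap_eq_zero_iff_mul_fundIdempotent (a : RelAlg k (Irr T)) :
    gammaMap k T _ a.asHom = 0 ↔
      PermOrderAlg.proj k (Irr T) a * fundIdempotent k (irrOrder T) = 0 := by
  refine ⟨fun h => ?_, gammaMap_eq_zero_of_mul_fundIdempotent k⟩
  let : Fintype (Equiv.Perm (Irr T)) := Fintype.ofFinite _
  rw [proj_mul_fundIdempotent_eq_sum]
  refine Finset.sum_eq_zero fun τ _ => ?_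
  rw [(gammaMap_eq_zero_iff k (X := FinCorr.mk (Irr T)) _).1 h, zero_smul]

end Annihilators

/-! ### Assembly: equality of kernels and spanning elements. -/

section Main

variable (k : Type v) [CommRing k] (T : Type u) [Lattice T] [BoundedOrder T] [Finite T]

/-- The generator `f_R` of the fundamental module. -/
def FundModule.generator {E : Type u} [Finite E] (R : OrderRel E) : FundModule k R :=
  ⟨fundIdempotent k R, Ideal.subset_span rfl⟩

lemma FundModule.exists_smul_generator {E : Type u} [Finite E] (R : OrderRel E)
    (y : FundModule k R) : ∃ a : RelAlg k E, y = a • FundModule.generator k R := by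
  obtain ⟨p, hp⟩ := Ideal.mem_span_singleton'.1 y.2
  obtain ⟨a, rfl⟩ := PermOrderAlg.proj_surjective k p
  exact ⟨a, Subtype.ext hp.symm⟩

/-- The comparison on E applies to each α ≫ ψ; returning from E to X uses that correspondences into
E separate ⟨γ_T⟩(X). -/
lemma gammaMap_eq_zero_iff_smul_generator (X : LinCorr.{u, v} k)
    (α : LinCorr.of k (Irr T) ⟶ X) :
    gammaMap k T X α = 0 ↔ ∀ ψ : X ⟶ LinCorr.of k (Irr T),
      End.of (α ≫ ψ) • FundModule.generator k (irrOrder T) = 0 := by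
  have h (ψ : X ⟶ LinCorr.of k (Irr T)) :
      End.of (α ≫ ψ) • FundModule.generator k (irrOrder T) = 0 ↔
        gammaMap k T _ (α ≫ ψ) = 0 :=
    Subtype.ext_iff.trans (gammaMap_eq_zero_iff_mul_fundIdempotent k (End.of (α ≫ ψ))).symm
  simp only [h]
  refine ⟨fun hα ψ => ?_, gammaMap_eq_zero_of_comp k α⟩
  rw [gammaMap_comp, hα]
  exact map_zero _

lemma generatedBy_gammaElem_obj (X : Type u) [Finite X] :
    (ModSubfunctor.generatedBy (latticeFunctor k Tᵒᵈ) (gammaElem k T)).obj (LinCorr.of k X) =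
      Submodule.span k (Set.range fun S : Set (X × Irr T) =>
        ((latticeFunctor k Tᵒᵈ).map (LinCorr.corr k S)).hom (gammaElem k T)) := by
  rw [generatedBy_obj_eq_range]
  have htop : (⊤ : Submodule k (LinCorr.of k (Irr T) ⟶ LinCorr.of k X)) =
      Submodule.span k (Set.range fun S : Set (X × Irr T) => LinCorr.corr k S) :=
    ((Finsupp.basisSingleOne (R := k) (ι := Set (X × Irr T))).span_eq.symm).trans
      (by rw [Finsupp.coe_basisSingleOne]; rfl)
  rw [LinearMap.range_eq_map, htop, Submodule.map_span, ← Set.range_comp]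
  rfl

end Main

end

theorem mainTheorem6 (k : Type v) [CommRing k]
    (T : Type u) [Lattice T] [BoundedOrder T] [Finite T] :
    Nonempty ((ModSubfunctor.generatedBy (latticeFunctor k Tᵒᵈ) (gammaElem k T)).toFunctor ≅
        fundamentalFunctor k (irrOrder T)) ∧
      ∀ (X : Type u) [Finite X],
        (ModSubfunctor.generatedBy (latticeFunctor k Tᵒᵈ) (gammaElem k T)).obj (LinCorr.of k X) =
            Submodule.span k (Set.range fun S : Set (X × Irr T) =>
              ((latticeFunctor k Tᵒᵈ).map (LinCorr.corr k S)).hom (gammaElem k T)) ∧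
          Nonempty ((fundamentalFunctor k (irrOrder T)).obj (LinCorr.of k X) ≃ₗ[k]
            Submodule.span k (Set.range fun S : Set (X × Irr T) =>
              ((latticeFunctor k Tᵒᵈ).map (LinCorr.corr k S)).hom (gammaElem k T))) := by
  have hiso : Nonempty
      ((ModSubfunctor.generatedBy (latticeFunctor k Tᵒᵈ) (gammaElem k T)).toFunctor ≅
        fundamentalFunctor k (irrOrder T)) :=
    nonempty_generatedBy_iso (F := latticeFunctor k Tᵒᵈ) (gammaElem k T)
      (FundModule.exists_smul_generator k (irrOrder T))
      (gammaMap_eq_zero_iff_smul_generator k T)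
  refine ⟨hiso, fun X _ => ⟨generatedBy_gammaElem_obj k T X, ?_⟩⟩
  obtain ⟨e⟩ := hiso
  have e' := (e.app (LinCorr.of k X)).toLinearEquiv
  exact ⟨e'.symm.trans (LinearEquiv.ofEq _ _ (generatedBy_gammaElem_obj k T X))⟩
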